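/- Let $\mathcal D_0$ be the set of Dirichlet series $\sum_{n\ge 2} c_n n^{-s}$ with complex coefficients (that is, with zero constant term $c_1=0$) that converge absolutely in some half-plane $\mathbb C_\theta=\{s\in\mathbb C:\operatorname{Re}(s)>\theta\}$, $\theta\in\mathbb R$. Let $f\in\mathcal D_0$ and $w\in\mathbb C$. (i) The equation $f(s-w\,g(s))=g(s)$ (understood to hold for all $s$ in some half-plane on which $g(s)$ and $f(s-w\,g(s))$ are given by absolutely convergent series) has a unique solution $g\in\mathcal D_0$. (ii) There is a unique family of polynomials $\alpha_n\in\mathbb C[x]$, $n\ge 1$, such that for every $x\in\mathbb C$ $$e^{x f(s)}=\sum_{n\ge 1}\frac{\alpha_n(x)}{n^s},$$ with absolute convergence in some half-plane. It satisfies $\alpha_n(x+y)=\sum_{d\mid n}\alpha_d(x)\,\alpha_{n/d}(y)$ for all $n\ge 1$ and $x,y\in\mathbb C$, and for $n\ge 2$ the function $\hat\alpha_n(x):=\alpha_n(x)/x$ is a polynomial (whose value at $x=0$ is understood accordingly). The solution $g$ in (i) is $$g(s)=\sum_{n\ge 2}\frac{\hat\alpha_n(w\ln n)}{n^s},$$ and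 it satisfies $$e^{x g(s)}=1+x\sum_{n\ge 2}\frac{\hat\alpha_n(x+w\ln n)}{n^s},\qquad x\in\mathbb C.$$ The last two Dirichlet series converge absolutely, and these identities hold, in some half-plane $\mathbb C_\theta$, where $\theta$ does not depend on $x$. -/

import Mathlib

open Polynomial

namespace DirichletLagrange

/-- A Dirichlet series `∑ cₙ n⁻ˢ`, given by its coefficients (an arithmetic function, so only the
indices `n ≥ 1` matter), belongs to the class `𝒟₀`: its constant term `c₁` is zero and it
converges absolutely in some half-plane `{s | θ < Re s}`. -/
def MemD₀ (c : ArithmeticFunction ℂ) : Prop :=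
  c 1 = 0 ∧ ∃ θ : ℝ, ∀ s : ℂ, θ < s.re → LSeriesSummable c s

/-- The Dirichlet series `g` solves `f (s - w g(s)) = g(s)`: throughout some half-plane both sides
are given by absolutely convergent series and they agree. -/
def Solves (f : ArithmeticFunction ℂ) (w : ℂ) (g : ArithmeticFunction ℂ) : Prop :=
  ∃ θ : ℝ, ∀ s : ℂ, θ < s.re →
    LSeriesSummable g s ∧ LSeriesSummable f (s - w * LSeries g s) ∧
      LSeries f (s - w * LSeries g s) = LSeries g s

/-- The polynomials `αₙ`, `n ≥ 1`, are generated by `f`: for every complex `x`,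
`exp (x f(s)) = ∑ αₙ(x) n⁻ˢ` with absolute convergence in some half-plane. -/
def Generates (f : ArithmeticFunction ℂ) (α : ArithmeticFunction ℂ[X]) : Prop :=
  ∀ x : ℂ, ∃ θ : ℝ, ∀ s : ℂ, θ < s.re →
    LSeriesSummable f s ∧
      LSeriesHasSum (fun n => (α n).eval x) s (Complex.exp (x * LSeries f s))

/-- Dirichlet convolution polynomials: `αₙ(x + y) = ∑_{d ∣ n} α_d(x) α_{n/d}(y)`. -/
def IsDirichletConvolution (α : ArithmeticFunction ℂ[X]) : Prop :=
  ∀ n : ℕ, 1 ≤ n → ∀ x y : ℂ,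
    (α n).eval (x + y) = ∑ d ∈ n.divisors, (α d).eval x * (α (n / d)).eval y

/-- The polynomial `p(x) / x`, for a polynomial `p` with `p(0) = 0`. -/
noncomputable def hat (p : ℂ[X]) : ℂ[X] := p.divX

/-- The coefficients of the Dirichlet series `∑_{n ≥ 2} α̂ₙ(x + w ln n) n⁻ˢ`. -/
noncomputable def hatCoeff (α : ArithmeticFunction ℂ[X]) (w x : ℂ) (n : ℕ) : ℂ :=
  if 2 ≤ n then (hat (α n)).eval (x + w * (Real.log n : ℂ)) else 0

end DirichletLagrange

namespace DirichletLagrange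

open LSeries Finset

/-! Everything is reduced to coefficients. Since `n^{-(s - w g)} = n^{-s} e^{w ln n g}`, the
equation `f(s - w g) = g` means `shiftComp w g f = g`, by uniqueness of coefficients. The Lagrange
formula is proved by strong induction on the index, in the form `E(m)`: `e^{y g}` has `m`-th
coefficient `y * hatExpCoeff f (y + w ln m) m`. If `n k = m`, then `w ln n + w ln k = w ln m`, so
`E(k)` turns the coefficients of `e^{w ln n g}` into those of `e^{w ln m f}`, up to the factor `ln n
/ ln m` (`log_mul_expCoeff_of_mul_eq`). The convolution that results is evaluated by the derivation
`c_n ↦ ln n c_n` (`log_mul_hatExpCoeff`); for `E(m)` one also uses that substitution commutes with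
the exponential (`shiftComp_expCoeff`). The same induction serves uniqueness and existence
(`shiftComp_eq_and_expCoeff_eq`); convergence of the explicit series comes from
`norm_hatExpCoeff_le`. -/

/-! ### Products and powers of Dirichlet series -/

/-- Group the pairs by their product. Vanishing on the axes is needed because the fibre over `0` is
infinite while `Nat.divisorsAntidiagonal 0` is empty. -/
theorem hasSum_sum_divisorsAntidiagonal {E : Type*} [NormedAddCommGroup E] [CompleteSpace E]
    {F : ℕ × ℕ → E} {S : E} (hF : HasSum F S) (h₁ : ∀ k, F (0, k) = 0) (h₂ : ∀ n, F (n, 0) = 0) :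
    HasSum (fun m : ℕ => ∑ p ∈ m.divisorsAntidiagonal, F p) S := by
  have key := hF.tsum_fiberwise (fun p : ℕ × ℕ => p.1 * p.2)
  refine key.congr_fun fun m => ?_
  rcases eq_or_ne m 0 with rfl | hm
  · have : ∀ p : (fun p : ℕ × ℕ => p.1 * p.2) ⁻¹' {0}, F p = 0 := by
      rintro ⟨⟨a, b⟩, hp⟩
      rcases Nat.mul_eq_zero.mp (by simpa using hp) with rfl | rfl
      · exact h₁ _
      · exact h₂ _
    simp [this]
  · rw [show (fun p : ℕ × ℕ => p.1 * p.2) ⁻¹' {m} = m.divisorsAntidiagonal by ext; simp [hm],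
      Finset.tsum_subtype' m.divisorsAntidiagonal F]

theorem term_mul (a b : ArithmeticFunction ℂ) (s : ℂ) (n : ℕ) :
    term (a * b : ArithmeticFunction ℂ) s n =
      ∑ p ∈ n.divisorsAntidiagonal, term a s p.1 * term b s p.2 := by
  rw [← ArithmeticFunction.coe_mul, term_convolution]

theorem tsum_norm_term_mul_le {a b : ArithmeticFunction ℂ} {s : ℂ} (ha : LSeriesSummable a s)
    (hb : LSeriesSummable b s) :
    ∑' n, ‖term (a * b : ArithmeticFunction ℂ) s n‖ ≤
      (∑' n, ‖term a s n‖) * ∑' n, ‖term b s n‖ := by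
  have hs := (Summable.mul_of_nonneg ha.norm hb.norm (fun _ => norm_nonneg _)
    (fun _ => norm_nonneg _))
  have h := hasSum_sum_divisorsAntidiagonal (ha.norm.hasSum.mul hb.norm.hasSum hs)
    (by simp) (by simp)
  rw [← h.tsum_eq]
  refine Summable.tsum_le_tsum (fun n => ?_) (ArithmeticFunction.LSeriesSummable_mul ha hb).norm
    h.summable
  rw [term_mul]
  exact (norm_sum_le _ _).trans (by simp)

/-- A product of `k` factors, each at least 2, is at least `2 ^ k > k`. Hence exponential series are
finite sums in each coefficient, and truncating them at `n` loses nothing. -/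
theorem pow_apply_eq_zero {c : ArithmeticFunction ℂ} (hc : c 1 = 0) {n k : ℕ} (h : n ≤ k) :
    (c ^ k) n = 0 := by
  induction k generalizing n with
  | zero => simp [Nat.le_zero.mp h]
  | succ k ih =>
    rw [pow_succ', ArithmeticFunction.mul_apply]
    refine Finset.sum_eq_zero fun p hp => ?_
    obtain ⟨hp, hn⟩ := Nat.mem_divisorsAntidiagonal.mp hp
    rcases eq_or_ne p.1 1 with h1 | h1
    · simp [h1, hc]
    · rw [ih, mul_zero]
      have : p.1 ≠ 0 := by rintro h0; simp [h0] at hp; omega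
      have : p.2 ≠ 0 := by rintro h0; simp [h0] at hp; omega
      nlinarith [show 2 ≤ p.1 by omega, show 1 ≤ p.2 by omega]

theorem pow_apply_congr {a b : ArithmeticFunction ℂ} {m : ℕ} (h : ∀ j ≤ m, a j = b j) (k : ℕ) :
    ∀ j ≤ m, (a ^ k) j = (b ^ k) j := by
  induction k with
  | zero => simp
  | succ k ih =>
    intro j hj
    rw [pow_succ', pow_succ', ArithmeticFunction.mul_apply, ArithmeticFunction.mul_apply]
    refine Finset.sum_congr rfl fun p hp => ?_
    rw [h _ ((Nat.divisor_le (Nat.fst_mem_divisors_of_mem_antidiagonal hp)).trans hj),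
      ih _ ((Nat.divisor_le (Nat.snd_mem_divisors_of_mem_antidiagonal hp)).trans hj)]

theorem term_one (s : ℂ) (n : ℕ) :
    term (1 : ArithmeticFunction ℂ) s n = if n = 1 then 1 else 0 := by
  rw [← term_delta]
  exact term_congr (fun {n} _ => by simp [ArithmeticFunction.one_apply, delta]) s n

theorem LSeriesHasSum_one (s : ℂ) : LSeriesHasSum (1 : ArithmeticFunction ℂ) s 1 := by
  rw [LSeriesHasSum, funext (term_one s)]
  exact hasSum_ite_eq 1 1

theorem LSeriesHasSum_pow {c : ArithmeticFunction ℂ} {s : ℂ} (hc : LSeriesSummable c s) (k : ℕ) :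
    LSeriesHasSum (c ^ k : ArithmeticFunction ℂ) s (LSeries c s ^ k) := by
  induction k with
  | zero => simpa using LSeriesHasSum_one s
  | succ k ih =>
    rw [pow_succ, pow_succ]
    exact ArithmeticFunction.LSeriesHasSum_mul ih hc.LSeriesHasSum

theorem tsum_norm_term_pow_le {c : ArithmeticFunction ℂ} {s : ℂ} (hc : LSeriesSummable c s)
    (k : ℕ) :
    ∑' n, ‖term (c ^ k : ArithmeticFunction ℂ) s n‖ ≤ (∑' n, ‖term c s n‖) ^ k := by
  induction k with
  | zero =>
    simp [term_one, apply_ite norm]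
  | succ k ih =>
    rw [pow_succ, pow_succ]
    refine (tsum_norm_term_mul_le (LSeriesHasSum_pow hc k).summable hc).trans ?_
    gcongr

/-! ### Exponentials of Dirichlet series -/

/-- The coefficients of `exp (x c(s))`, where `c(s) = ∑ cₙ n⁻ˢ` has zero constant term. -/
noncomputable def expCoeff (c : ArithmeticFunction ℂ) (x : ℂ) : ArithmeticFunction ℂ where
  toFun n := ∑ k ∈ range n, x ^ k / (k.factorial : ℂ) * (c ^ k) n
  map_zero' := by simp

/-- The coefficients of `(exp (x c(s)) - 1) / x`, where `c(s) = ∑ cₙ n⁻ˢ` has zero constant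
term. -/
noncomputable def hatExpCoeff (c : ArithmeticFunction ℂ) (x : ℂ) : ArithmeticFunction ℂ where
  toFun n := ∑ k ∈ range n, x ^ k / ((k + 1).factorial : ℂ) * (c ^ (k + 1)) n
  map_zero' := by simp

theorem expCoeff_apply (c : ArithmeticFunction ℂ) (x : ℂ) (n : ℕ) :
    expCoeff c x n = ∑ k ∈ range n, x ^ k / (k.factorial : ℂ) * (c ^ k) n := rfl

theorem hatExpCoeff_apply (c : ArithmeticFunction ℂ) (x : ℂ) (n : ℕ) :
    hatExpCoeff c x n =
      ∑ k ∈ range n, x ^ k / ((k + 1).factorial : ℂ) * (c ^ (k + 1)) n := rfl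

theorem expCoeff_apply_one (c : ArithmeticFunction ℂ) (x : ℂ) : expCoeff c x 1 = 1 := by
  simp [expCoeff_apply]

theorem hatExpCoeff_apply_one {c : ArithmeticFunction ℂ} (hc : c 1 = 0) (x : ℂ) :
    hatExpCoeff c x 1 = 0 := by
  simp [hatExpCoeff_apply, hc]

theorem mul_hatExpCoeff {c : ArithmeticFunction ℂ} (hc : c 1 = 0) (x : ℂ) {n : ℕ} (hn : 2 ≤ n) :
    x * hatExpCoeff c x n = expCoeff c x n := by
  obtain ⟨n, rfl⟩ : ∃ m, n = m + 1 := ⟨n - 1, by omega⟩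
  -- The top term of the hat sum and the constant term of the exponential sum both vanish; the rest
  -- match after a shift of `k`.
  rw [expCoeff_apply, hatExpCoeff_apply,
    sum_range_succ (fun k => x ^ k / ((k + 1).factorial : ℂ) * (c ^ (k + 1)) (n + 1)),
    sum_range_succ', pow_apply_eq_zero hc (le_refl (n + 1)), pow_zero, pow_zero,
    ArithmeticFunction.one_apply_ne (by omega : n + 1 ≠ 1)]
  simp only [mul_zero, add_zero, mul_sum]
  exact sum_congr rfl fun k _ => by ring

theorem expCoeff_zero {c : ArithmeticFunction ℂ} {n : ℕ} (hn : 2 ≤ n) : expCoeff c 0 n = 0 := by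
  rw [expCoeff_apply, sum_eq_zero]
  intro k _
  rcases k with _ | k
  · simp [ArithmeticFunction.one_apply_ne (by omega : n ≠ 1)]
  · simp

theorem expCoeff_congr {a b : ArithmeticFunction ℂ} {m : ℕ} (h : ∀ j ≤ m, a j = b j) (x : ℂ) :
    expCoeff a x m = expCoeff b x m := by
  simp only [expCoeff_apply, pow_apply_congr h _ m le_rfl]

/-- Submultiplicativity of the `ℓ¹` norm bounds row `k` by the `k`-th term of a real exponential
series. This justifies exchanging the sums over `k` and `n`. -/
theorem summable_norm_exp_family {c : ArithmeticFunction ℂ} {s : ℂ} (hs : LSeriesSummable c s)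
    (x : ℂ) :
    Summable (fun p : ℕ × ℕ =>
        ‖x ^ p.1 / (p.1.factorial : ℂ) * term (c ^ p.1 : ArithmeticFunction ℂ) s p.2‖) ∧
      ∑' p : ℕ × ℕ,
        ‖x ^ p.1 / (p.1.factorial : ℂ) * term (c ^ p.1 : ArithmeticFunction ℂ) s p.2‖ ≤
      Real.exp (‖x‖ * ∑' n, ‖term c s n‖) := by
  set K := ∑' n, ‖term c s n‖
  have h₁ (k : ℕ) : Summable fun n =>
      ‖x ^ k / (k.factorial : ℂ) * term (c ^ k : ArithmeticFunction ℂ) s n‖ := by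
    simp only [norm_mul]
    exact ((LSeriesHasSum_pow hs k).summable.norm).mul_left _
  have h₂ (k : ℕ) : ∑' n, ‖x ^ k / (k.factorial : ℂ) * term (c ^ k : ArithmeticFunction ℂ) s n‖ ≤
      (‖x‖ * K) ^ k / k.factorial := by
    simp only [norm_mul, tsum_mul_left, norm_div, norm_pow, RCLike.norm_natCast]
    rw [mul_pow, mul_div_right_comm]
    gcongr
    exact tsum_norm_term_pow_le hs k
  have h₃ := Real.summable_pow_div_factorial (‖x‖ * K)
  have h₄ := h₃.of_nonneg_of_le (fun k => tsum_nonneg fun n => norm_nonneg _) h₂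
  have h₅ : Summable fun p : ℕ × ℕ =>
      ‖x ^ p.1 / (p.1.factorial : ℂ) * term (c ^ p.1 : ArithmeticFunction ℂ) s p.2‖ :=
    (summable_prod_of_nonneg fun p => norm_nonneg _).mpr ⟨h₁, h₄⟩
  refine ⟨h₅, ?_⟩
  rw [h₅.tsum_prod' h₁, Real.exp_eq_exp_ℝ, NormedSpace.exp_eq_tsum_div]
  exact h₄.tsum_le_tsum h₂ h₃

theorem hasSum_exp_family_fiber {c : ArithmeticFunction ℂ} (hc : c 1 = 0) (s x : ℂ) (n : ℕ) :
    HasSum (fun k : ℕ => x ^ k / (k.factorial : ℂ) * term (c ^ k : ArithmeticFunction ℂ) s n)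
      (term (expCoeff c x) s n) := by
  rcases eq_or_ne n 0 with rfl | hn
  · simp
  have h := hasSum_sum_of_ne_finset_zero (s := range n) (L := .unconditional ℕ)
    (f := fun k : ℕ => x ^ k / (k.factorial : ℂ) * term (c ^ k : ArithmeticFunction ℂ) s n)
    (fun k hk => by
      rw [term_of_ne_zero hn, pow_apply_eq_zero hc (by simpa using hk)]; simp)
  convert h using 1
  rw [term_of_ne_zero hn, expCoeff_apply, sum_div]
  exact sum_congr rfl fun k _ => by rw [term_of_ne_zero hn, mul_div_assoc]

theorem LSeriesHasSum_expCoeff {c : ArithmeticFunction ℂ} (hc : c 1 = 0) {s : ℂ}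
    (hs : LSeriesSummable c s) (x : ℂ) :
    LSeriesHasSum (expCoeff c x) s (Complex.exp (x * LSeries c s)) := by
  have h := (summable_norm_exp_family hs x).1.of_norm
  have h₁ (k : ℕ) : HasSum (fun n =>
      x ^ k / (k.factorial : ℂ) * term (c ^ k : ArithmeticFunction ℂ) s n)
      ((x * LSeries c s) ^ k / k.factorial) := by
    have := (LSeriesHasSum_pow hs k).mul_left (x ^ k / (k.factorial : ℂ))
    rwa [div_mul_eq_mul_div, ← mul_pow] at this
  have h₂ := h.hasSum.prod_fiberwise h₁
  have h₃ : HasSum (fun k : ℕ => (x * LSeries c s) ^ k / (k.factorial : ℂ))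
      (Complex.exp (x * LSeries c s)) := by
    rw [Complex.exp_eq_exp_ℂ]
    exact NormedSpace.expSeries_div_hasSum_exp _
  have h₄ := h.hasSum
  rw [h₂.unique h₃] at h₄
  exact ((Equiv.prodComm ℕ ℕ).hasSum_iff.mpr h₄).prod_fiberwise
    (hasSum_exp_family_fiber hc s x)

theorem tsum_norm_term_expCoeff_le {c : ArithmeticFunction ℂ} (hc : c 1 = 0) {s : ℂ}
    (hs : LSeriesSummable c s) (x : ℂ) :
    ∑' n, ‖term (expCoeff c x) s n‖ ≤ Real.exp (‖x‖ * ∑' n, ‖term c s n‖) := by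
  obtain ⟨h, hle⟩ := summable_norm_exp_family hs x
  refine le_trans ?_ hle
  have h' := (Equiv.prodComm ℕ ℕ).summable_iff.mpr h
  rw [← (Equiv.prodComm ℕ ℕ).tsum_eq (fun p : ℕ × ℕ =>
    ‖x ^ p.1 / (p.1.factorial : ℂ) * term (c ^ p.1 : ArithmeticFunction ℂ) s p.2‖)]
  refine le_of_le_of_eq ?_ h'.tsum_prod.symm
  refine (LSeriesHasSum_expCoeff hc hs x).summable.norm.tsum_le_tsum (fun n => ?_) h'.prod
  rw [← (hasSum_exp_family_fiber hc s x n).tsum_eq]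
  exact norm_tsum_le_tsum_norm (h'.prod_factor n)

/-! ### Uniqueness of coefficients and the logarithmic derivation -/

theorem eq_of_LSeries_eq {a b : ArithmeticFunction ℂ} {θ : ℝ} {u : ℂ → ℂ}
    (ha : ∀ s : ℂ, θ < s.re → LSeriesHasSum a s (u s))
    (hb : ∀ s : ℂ, θ < s.re → LSeriesHasSum b s (u s)) : a = b := by
  have hlt {c : ArithmeticFunction ℂ} (hc : ∀ s : ℂ, θ < s.re → LSeriesHasSum c s (u s)) :
      abscissaOfAbsConv c < ⊤ :=
    (LSeries.abscissaOfAbsConv_le_of_forall_lt_LSeriesSummable (x := θ)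
      fun y hy => (hc y (by simpa using hy)).summable).trans_lt (EReal.coe_lt_top θ)
  ext n
  rcases eq_or_ne n 0 with rfl | hn
  · simp
  refine LSeries.eq_of_LSeries_eventually_eq (hlt ha) (hlt hb) ?_ hn
  filter_upwards [Filter.eventually_gt_atTop θ] with y hy
  rw [(ha y (by simpa using hy)).LSeries_eq, (hb y (by simpa using hy)).LSeries_eq]

/-- Multiplication of the coefficients by `ln n`, that is, `-d/ds` on Dirichlet series. -/
noncomputable def logMul (c : ArithmeticFunction ℂ) : ArithmeticFunction ℂ where
  toFun n := (Real.log n : ℂ) * c n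
  map_zero' := by simp

theorem logMul_apply (c : ArithmeticFunction ℂ) (n : ℕ) :
    logMul c n = (Real.log n : ℂ) * c n := rfl

theorem log_eq_add_of_mem_divisorsAntidiagonal {n : ℕ} {p : ℕ × ℕ}
    (hp : p ∈ n.divisorsAntidiagonal) :
    (Real.log n : ℂ) = (Real.log p.1 : ℂ) + (Real.log p.2 : ℂ) := by
  obtain ⟨h₁, h₂⟩ := Nat.ne_zero_of_mem_divisorsAntidiagonal hp
  rw [← (Nat.mem_divisorsAntidiagonal.mp hp).1, Nat.cast_mul,
    Real.log_mul (by exact_mod_cast h₁) (by exact_mod_cast h₂), Complex.ofReal_add]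

theorem logMul_mul (a b : ArithmeticFunction ℂ) :
    logMul (a * b) = logMul a * b + a * logMul b := by
  ext n
  simp only [logMul_apply, ArithmeticFunction.add_apply, ArithmeticFunction.mul_apply, mul_sum,
    ← sum_add_distrib]
  refine sum_congr rfl fun p hp => ?_
  rw [log_eq_add_of_mem_divisorsAntidiagonal hp]
  ring

theorem logMul_pow_succ (c : ArithmeticFunction ℂ) (k : ℕ) :
    logMul (c ^ (k + 1)) = (k + 1) * (logMul c * c ^ k) := by
  induction k with
  | zero => simp
  | succ k ih =>
    rw [pow_succ, logMul_mul, ih]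
    push_cast
    ring

theorem natCast_add_one_mul_apply (k : ℕ) (a : ArithmeticFunction ℂ) (n : ℕ) :
    (((k : ArithmeticFunction ℂ) + 1) * a) n = ((k : ℂ) + 1) * a n := by
  have : ((k : ArithmeticFunction ℂ) + 1) * a = (k + 1) • a := by
    rw [nsmul_eq_mul]; push_cast; ring
  rw [this]
  have h (j : ℕ) : (j • a) n = (j : ℂ) * a n := by
    induction j with
    | zero => simp
    | succ j ih => rw [succ_nsmul, ArithmeticFunction.add_apply, ih]; push_cast; ring
  rw [h]; push_cast; ring

theorem expCoeff_apply_of_le {c : ArithmeticFunction ℂ} (hc : c 1 = 0) (x : ℂ) {n N : ℕ}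
    (h : n ≤ N) : expCoeff c x n = ∑ k ∈ range N, x ^ k / (k.factorial : ℂ) * (c ^ k) n := by
  rw [expCoeff_apply]
  refine sum_subset (range_mono h) fun k _ hk => ?_
  rw [pow_apply_eq_zero hc (by simpa using hk), mul_zero]

/-- Coefficient form of `((e^{x c} - 1) / x)' = c' e^{x c}`. Working with the hat avoids dividing by
`x`, so `x = 0` is included. -/
theorem log_mul_hatExpCoeff {c : ArithmeticFunction ℂ} (hc : c 1 = 0) (x : ℂ) (n : ℕ) :
    (Real.log n : ℂ) * hatExpCoeff c x n = (logMul c * expCoeff c x) n := by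
  have h : (logMul c * expCoeff c x) n =
      ∑ k ∈ range n, x ^ k / (k.factorial : ℂ) * (logMul c * c ^ k) n := by
    simp only [ArithmeticFunction.mul_apply, mul_sum]
    rw [sum_comm]
    refine sum_congr rfl fun p hp => ?_
    rw [expCoeff_apply_of_le hc x
      (Nat.divisor_le (Nat.snd_mem_divisors_of_mem_antidiagonal hp)), mul_sum]
    exact sum_congr rfl fun k _ => by ring
  rw [h, hatExpCoeff_apply, mul_sum]
  refine sum_congr rfl fun k _ => ?_
  rw [mul_left_comm, ← logMul_apply, logMul_pow_succ, natCast_add_one_mul_apply,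
    Nat.factorial_succ]
  have h₁ : (k.factorial : ℂ) ≠ 0 := by exact_mod_cast k.factorial_ne_zero
  have h₂ : (k : ℂ) + 1 ≠ 0 := by exact_mod_cast k.succ_ne_zero
  push_cast
  field_simp

theorem logMul_expCoeff {c : ArithmeticFunction ℂ} (hc : c 1 = 0) (x : ℂ) (n : ℕ) :
    logMul (expCoeff c x) n = x * (logMul c * expCoeff c x) n := by
  rw [← log_mul_hatExpCoeff hc, logMul_apply]
  rcases n with _ | _ | n
  · simp
  · simp
  · rw [← mul_hatExpCoeff hc x (by omega)]
    ring

theorem expCoeff_add {c : ArithmeticFunction ℂ} (hc : MemD₀ c) (x y : ℂ) :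
    expCoeff c (x + y) = expCoeff c x * expCoeff c y := by
  obtain ⟨hc₁, θ, hθ⟩ := hc
  refine eq_of_LSeries_eq (fun s hs => LSeriesHasSum_expCoeff hc₁ (hθ s hs) (x + y))
    fun s hs => ?_
  rw [add_mul, Complex.exp_add]
  exact ArithmeticFunction.LSeriesHasSum_mul (LSeriesHasSum_expCoeff hc₁ (hθ s hs) x)
    (LSeriesHasSum_expCoeff hc₁ (hθ s hs) y)

/-! ### The substitution `s ↦ s - w g(s)` -/

/-- The coefficients of `f(s - w g(s))`, where `g` has zero constant term. -/
noncomputable def shiftComp (w : ℂ) (g f : ArithmeticFunction ℂ) : ArithmeticFunction ℂ where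
  toFun m := ∑ p ∈ m.divisorsAntidiagonal,
    f p.1 * expCoeff g (w * (Real.log p.1 : ℂ)) p.2
  map_zero' := by simp

theorem shiftComp_apply (w : ℂ) (g f : ArithmeticFunction ℂ) (m : ℕ) :
    shiftComp w g f m = ∑ p ∈ m.divisorsAntidiagonal,
      f p.1 * expCoeff g (w * (Real.log p.1 : ℂ)) p.2 := rfl

theorem term_mul_exp_log (f : ArithmeticFunction ℂ) (s z : ℂ) (n : ℕ) :
    term f s n * Complex.exp (z * (Real.log n : ℂ)) = term f (s - z) n := by
  rcases eq_or_ne n 0 with rfl | hn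
  · simp
  have hn' : (n : ℂ) ≠ 0 := by exact_mod_cast hn
  rw [term_of_ne_zero hn, term_of_ne_zero hn, Complex.cpow_sub _ _ hn',
    Complex.cpow_def_of_ne_zero hn' z, ← Complex.natCast_log, mul_comm z,
    div_div_eq_mul_div, div_mul_eq_mul_div]

/-- Expand each `e^{w ln n g(s)}` and sum the double series in two orders. Taking norms replaces `w
g(s)` by at most `‖w‖ K`, which is why summability of `f` is required at that real shift. -/
theorem LSeriesHasSum_shiftComp {f g : ArithmeticFunction ℂ} (hg : g 1 = 0) {w s : ℂ}
    (hgs : LSeriesSummable g s)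
    (hfs : LSeriesSummable f (s - (‖w‖ * ∑' n, ‖term g s n‖ : ℝ))) :
    LSeriesSummable f (s - w * LSeries g s) ∧
      LSeriesHasSum (shiftComp w g f) s (LSeries f (s - w * LSeries g s)) := by
  set K := ∑' n, ‖term g s n‖ with hK
  have hf : LSeriesSummable f (s - w * LSeries g s) := by
    refine hfs.of_re_le_re ?_
    have : (w * LSeries g s).re ≤ ‖w‖ * K :=
      (Complex.re_le_norm _).trans <| by
        rw [norm_mul]; gcongr; exact norm_tsum_le_tsum_norm hgs.norm
    simp only [Complex.sub_re, Complex.ofReal_re]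
    linarith
  refine ⟨hf, ?_⟩
  let F : ℕ × ℕ → ℂ := fun p =>
    term f s p.1 * term (expCoeff g (w * (Real.log p.1 : ℂ))) s p.2
  have hexp (n : ℕ) := LSeriesHasSum_expCoeff hg hgs (w * (Real.log n : ℂ))
  have hrow (n : ℕ) : HasSum (fun k => F (n, k)) (term f (s - w * LSeries g s) n) := by
    rw [← term_mul_exp_log, mul_right_comm w]
    exact HasSum.mul_left (term f s n) (hexp n)
  have hnorm (n : ℕ) : ∑' k, ‖F (n, k)‖ ≤ ‖term f (s - (‖w‖ * K : ℝ)) n‖ := by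
    simp only [F, norm_mul, tsum_mul_left]
    rw [← term_mul_exp_log, norm_mul]
    gcongr
    refine (tsum_norm_term_expCoeff_le hg hgs _).trans ?_
    rw [Complex.norm_exp, norm_mul, Complex.norm_real, Real.norm_of_nonneg
      (Real.log_natCast_nonneg n), ← Complex.ofReal_mul, Complex.ofReal_re, mul_right_comm ‖w‖]
  have hF : Summable F := by
    refine Summable.of_norm ((summable_prod_of_nonneg fun p => norm_nonneg _).mpr
      ⟨fun n => ?_, hfs.norm.of_nonneg_of_le (fun n => tsum_nonneg fun k => norm_nonneg _) hnorm⟩)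
    simp only [F, norm_mul]
    exact Summable.mul_left ‖term f s n‖ (hexp n).summable.norm
  have h₁ := hF.hasSum
  rw [(h₁.prod_fiberwise hrow).unique hf.LSeriesHasSum] at h₁
  have h₂ := hasSum_sum_divisorsAntidiagonal h₁ (by simp [F]) (by simp [F])
  refine h₂.congr_fun fun m => ?_
  rcases eq_or_ne m 0 with rfl | hm
  · simp
  rw [term_of_ne_zero hm, shiftComp_apply, sum_div]
  refine sum_congr rfl fun p hp => ?_
  obtain ⟨hp₁, hp₂⟩ := Nat.ne_zero_of_mem_divisorsAntidiagonal hp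
  simp only [F]
  rw [term_of_ne_zero hp₁, term_of_ne_zero hp₂, div_mul_div_comm, ← Complex.natCast_mul_natCast_cpow,
    ← Nat.cast_mul, (Nat.mem_divisorsAntidiagonal.mp hp).1]

theorem exists_LSeriesHasSum_shiftComp {f g : ArithmeticFunction ℂ} {a : ℝ}
    (hf : LSeriesSummable f a) (hg : MemD₀ g) (w : ℂ) :
    ∃ θ : ℝ, ∀ s : ℂ, θ < s.re → LSeriesSummable g s ∧
      LSeriesSummable f (s - w * LSeries g s) ∧
      LSeriesHasSum (shiftComp w g f) s (LSeries f (s - w * LSeries g s)) := by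
  obtain ⟨hg₁, b, hb⟩ := hg
  have hgb := hb (b + 1 : ℝ) (by simp)
  -- The `ℓ¹` norm of `g` decreases with `Re s`, so to the right of `b + 1` one constant bounds the
  -- shift.
  refine ⟨max (b + 1) (a + ‖w‖ * ∑' n, ‖term g (b + 1 : ℝ) n‖), fun s hs => ?_⟩
  obtain ⟨h₁, h₂⟩ := max_lt_iff.mp hs
  have hgs := hb s (by linarith)
  refine ⟨hgs, LSeriesHasSum_shiftComp hg₁ hgs (hf.of_re_le_re ?_)⟩
  have : ‖w‖ * ∑' n, ‖term g s n‖ ≤ ‖w‖ * ∑' n, ‖term g (b + 1 : ℝ) n‖ := by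
    gcongr
    · exact hgs.norm
    · exact hgb.norm
    · exact norm_term_le_of_re_le_re _ (by simpa using h₁.le) _
  simp only [Complex.ofReal_re, Complex.sub_re]
  linarith

theorem shiftComp_one {f : ArithmeticFunction ℂ} (hf : f 1 = 0) (w : ℂ)
    (g : ArithmeticFunction ℂ) : shiftComp w g f 1 = 0 := by
  simp [shiftComp_apply, hf]

/-- Both sides are the coefficients of `exp (x f(s - w g(s)))`. -/
theorem shiftComp_expCoeff {f g : ArithmeticFunction ℂ} (hf : MemD₀ f) (hg : MemD₀ g) (w x : ℂ) :
    shiftComp w g (expCoeff f x) = expCoeff (shiftComp w g f) x := by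
  obtain ⟨hf₁, a, ha⟩ := hf
  have hfa := ha (a + 1 : ℝ) (by simp)
  obtain ⟨θ₁, h₁⟩ := exists_LSeriesHasSum_shiftComp hfa hg w
  obtain ⟨θ₂, h₂⟩ := exists_LSeriesHasSum_shiftComp
    (LSeriesHasSum_expCoeff hf₁ hfa x).summable hg w
  refine eq_of_LSeries_eq (θ := max θ₁ θ₂) (u := fun s =>
    Complex.exp (x * LSeries f (s - w * LSeries g s))) (fun s hs => ?_) (fun s hs => ?_)
  · obtain ⟨-, hfs, -⟩ := h₁ s (lt_of_le_of_lt (le_max_left _ _) hs)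
    have h := (h₂ s (lt_of_le_of_lt (le_max_right _ _) hs)).2.2
    rwa [(LSeriesHasSum_expCoeff hf₁ hfs x).LSeries_eq] at h
  · obtain ⟨-, -, h⟩ := h₁ s (lt_of_le_of_lt (le_max_left _ _) hs)
    have := LSeriesHasSum_expCoeff (shiftComp_one hf₁ w g) h.summable x
    rwa [h.LSeries_eq] at this

/-! ### The inductive Lagrange formula -/

theorem log_natCast_ne_zero {m : ℕ} (hm : 2 ≤ m) : (Real.log m : ℂ) ≠ 0 := by
  exact_mod_cast (Real.log_pos (by exact_mod_cast hm : (1 : ℝ) < m)).ne'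

/-- Apply the induction hypothesis at `k < m` with `y = w ln n`: its argument becomes `w ln m`, and
the prefactor `w ln n`, multiplied by `ln m`, leaves `w ln m` to be absorbed by `mul_hatExpCoeff`.
-/
theorem log_mul_expCoeff_of_mul_eq {f g : ArithmeticFunction ℂ} (hf : f 1 = 0) {w : ℂ} {m : ℕ}
    (ih : ∀ j, 2 ≤ j → j < m → ∀ y,
      expCoeff g y j = y * hatExpCoeff f (y + w * (Real.log j : ℂ)) j)
    {n k : ℕ} (hnk : n * k = m) (hn : 2 ≤ n) (hm : m ≠ 0) :
    (Real.log m : ℂ) * expCoeff g (w * (Real.log n : ℂ)) k =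
      (Real.log n : ℂ) * expCoeff f (w * (Real.log m : ℂ)) k := by
  have hk : k ≠ 0 := by rintro rfl; exact hm (by simpa using hnk.symm)
  rcases eq_or_ne k 1 with rfl | hk1
  · rw [mul_one] at hnk
    simp [expCoeff_apply_one, hnk]
  have hlog : (Real.log m : ℂ) = (Real.log n : ℂ) + (Real.log k : ℂ) :=
    log_eq_add_of_mem_divisorsAntidiagonal (p := (n, k)) (by simp [hnk, hm])
  rw [ih k (by omega) (by rw [← hnk]; nlinarith [Nat.pos_of_ne_zero hk]), ← mul_add, ← hlog,
    ← mul_hatExpCoeff hf _ (by omega : 2 ≤ k)]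
  ring

/-- The right side involves only `f`: this is what determines the next coefficient of a solution. -/
theorem shiftComp_apply_eq {f g : ArithmeticFunction ℂ} (hf : f 1 = 0) {w : ℂ} {m : ℕ}
    (hm : 2 ≤ m)
    (ih : ∀ j, 2 ≤ j → j < m → ∀ y,
      expCoeff g y j = y * hatExpCoeff f (y + w * (Real.log j : ℂ)) j) :
    shiftComp w g f m = hatExpCoeff f (w * (Real.log m : ℂ)) m := by
  refine mul_left_cancel₀ (log_natCast_ne_zero hm) ?_
  rw [log_mul_hatExpCoeff hf, shiftComp_apply, ArithmeticFunction.mul_apply, mul_sum]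
  refine sum_congr rfl fun p hp => ?_
  obtain ⟨h₁, -⟩ := Nat.ne_zero_of_mem_divisorsAntidiagonal hp
  rcases eq_or_ne p.1 1 with h | h
  · simp [h, hf, logMul_apply]
  rw [mul_left_comm, log_mul_expCoeff_of_mul_eq hf ih (Nat.mem_divisorsAntidiagonal.mp hp).1
    (by omega) (by omega), logMul_apply]
  ring

/-- The computation of `shiftComp_apply_eq` with `e^{y f}` in place of `f`; the product `e^{y f}
e^{w ln m f}` produces the argument `y + w ln m`. -/
theorem expCoeff_apply_eq_of_shiftComp {f g : ArithmeticFunction ℂ} (hf : MemD₀ f) (hg : MemD₀ g)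
    {w : ℂ} {m : ℕ} (hm : 2 ≤ m)
    (ih : ∀ j, 2 ≤ j → j < m → ∀ y,
      expCoeff g y j = y * hatExpCoeff f (y + w * (Real.log j : ℂ)) j)
    (hfg : ∀ j ≤ m, shiftComp w g f j = g j) (y : ℂ) :
    expCoeff g y m = y * hatExpCoeff f (y + w * (Real.log m : ℂ)) m := by
  refine mul_left_cancel₀ (log_natCast_ne_zero hm) ?_
  have h : (Real.log m : ℂ) * (y * hatExpCoeff f (y + w * (Real.log m : ℂ)) m) =
      (logMul (expCoeff f y) * expCoeff f (w * (Real.log m : ℂ))) m := by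
    have : logMul (expCoeff f y) = y • (logMul f * expCoeff f y) := by
      ext n
      rw [logMul_expCoeff hf.1]; rfl
    rw [mul_left_comm, log_mul_hatExpCoeff hf.1, expCoeff_add hf, ← mul_assoc, this,
      smul_mul_assoc]
    rfl
  rw [h, ← expCoeff_congr hfg y, ← shiftComp_expCoeff hf hg, shiftComp_apply,
    ArithmeticFunction.mul_apply, mul_sum]
  refine sum_congr rfl fun p hp => ?_
  obtain ⟨h₁, -⟩ := Nat.ne_zero_of_mem_divisorsAntidiagonal hp
  have hpm := (Nat.mem_divisorsAntidiagonal.mp hp).1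
  -- Here the constant term of `e^{y f}` is 1, not 0; the summand vanishes because `ln 1 = 0` and
  -- `e^{0 g}` has no coefficient at `m ≥ 2`.
  rcases eq_or_ne p.1 1 with h' | h'
  · rw [h', one_mul] at hpm
    simp [h', logMul_apply, hpm, expCoeff_zero hm]
  rw [mul_left_comm, log_mul_expCoeff_of_mul_eq hf.1 ih hpm (by omega) (by omega), logMul_apply]
  ring

/-- The hypothesis `h` is shaped to hold both for a given solution (its conclusion is known) and for
the `g` defined by the explicit formula (its premise gives the conclusion). -/
theorem shiftComp_eq_and_expCoeff_eq {f g : ArithmeticFunction ℂ} (hf : MemD₀ f) (hg : MemD₀ g)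
    {w : ℂ}
    (h : ∀ m, 2 ≤ m → shiftComp w g f m = hatExpCoeff f (w * (Real.log m : ℂ)) m →
      shiftComp w g f m = g m) :
    shiftComp w g f = g ∧ ∀ m, 2 ≤ m → ∀ y,
      expCoeff g y m = y * hatExpCoeff f (y + w * (Real.log m : ℂ)) m := by
  have key (m : ℕ) : shiftComp w g f m = g m ∧ (2 ≤ m → ∀ y,
      expCoeff g y m = y * hatExpCoeff f (y + w * (Real.log m : ℂ)) m) := by
    induction m using Nat.strong_induction_on with
    | h m ih =>
      rcases lt_or_ge m 2 with hm | hm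
      · refine ⟨?_, fun h => by omega⟩
        interval_cases m
        · simp
        · rw [shiftComp_one hf.1, hg.1]
      have ih' : ∀ j, 2 ≤ j → j < m → ∀ y,
          expCoeff g y j = y * hatExpCoeff f (y + w * (Real.log j : ℂ)) j :=
        fun j hj hjm => (ih j hjm).2 hj
      have hm' := h m hm (shiftComp_apply_eq hf.1 hm ih')
      refine ⟨hm', fun _ => expCoeff_apply_eq_of_shiftComp hf hg hm ih' fun j hj => ?_⟩
      rcases hj.lt_or_eq with hj | rfl
      · exact (ih j hj).1
      · exact hm'
  exact ⟨ArithmeticFunction.ext fun m => (key m).1, fun m => (key m).2⟩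

/-! ### Growth of the coefficients and absolute convergence -/

theorem norm_pow_apply_le {c : ArithmeticFunction ℂ} {σ : ℝ} (hc : LSeriesSummable c σ) (k : ℕ)
    {n : ℕ} (hn : n ≠ 0) :
    ‖(c ^ k) n‖ ≤ (∑' n, ‖term c σ n‖) ^ k * (n : ℝ) ^ σ := by
  have h := ((LSeriesHasSum_pow hc k).summable.norm.le_tsum n fun _ _ => norm_nonneg _).trans
    (tsum_norm_term_pow_le hc k)
  rwa [norm_term_eq, if_neg hn, Complex.ofReal_re, div_le_iff₀ (by positivity)] at h

theorem norm_hatExpCoeff_le {c : ArithmeticFunction ℂ} {σ : ℝ} (hc : LSeriesSummable c σ) (t : ℂ)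
    {n : ℕ} (hn : n ≠ 0) :
    ‖hatExpCoeff c t n‖ ≤ (∑' n, ‖term c σ n‖) *
      Real.exp (‖t‖ * ∑' n, ‖term c σ n‖) * (n : ℝ) ^ σ := by
  set K := ∑' n, ‖term c σ n‖
  have hK : 0 ≤ K := tsum_nonneg fun _ => norm_nonneg _
  calc ‖hatExpCoeff c t n‖
      ≤ ∑ k ∈ range n, ‖t ^ k / ((k + 1).factorial : ℂ) * (c ^ (k + 1)) n‖ := by
        rw [hatExpCoeff_apply]; exact norm_sum_le _ _
    _ ≤ ∑ k ∈ range n, K * ((‖t‖ * K) ^ k / k.factorial) * (n : ℝ) ^ σ := by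
        refine sum_le_sum fun k _ => ?_
        rw [norm_mul, norm_div, norm_pow, RCLike.norm_natCast]
        calc ‖t‖ ^ k / (k + 1).factorial * ‖(c ^ (k + 1)) n‖
            ≤ ‖t‖ ^ k / k.factorial * (K ^ (k + 1) * (n : ℝ) ^ σ) := by
              gcongr
              · exact Nat.le_succ k
              · exact norm_pow_apply_le hc (k + 1) hn
          _ = K * ((‖t‖ * K) ^ k / k.factorial) * (n : ℝ) ^ σ := by ring
    _ = K * (∑ k ∈ range n, (‖t‖ * K) ^ k / k.factorial) * (n : ℝ) ^ σ := by
        rw [← sum_mul, mul_sum]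
    _ ≤ K * Real.exp (‖t‖ * K) * (n : ℝ) ^ σ := by
        gcongr
        exact Real.sum_le_exp_of_nonneg (by positivity) n

theorem exists_LSeriesSummable_hatExpCoeff {f : ArithmeticFunction ℂ} (hf : MemD₀ f) (w : ℂ) :
    ∃ θ : ℝ, ∀ (x s : ℂ), θ < s.re →
      LSeriesSummable (fun n => hatExpCoeff f (x + w * (Real.log n : ℂ)) n) s := by
  obtain ⟨-, a, ha⟩ := hf
  have hfa := ha (a + 1 : ℝ) (by simp)
  set K := ∑' n, ‖term f (a + 1 : ℝ) n‖ with hKdef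
  have hK : 0 ≤ K := tsum_nonneg fun _ => norm_nonneg _
  -- With `t = x + w ln n`, the factor `e^{‖t‖ K}` is at most `e^{‖x‖ K} n^{‖w‖ K}`: `x` enters only
  -- the constant, so the abscissa is uniform in `x`. The last `+ 1` makes the series converge.
  refine ⟨a + 1 + ‖w‖ * K + 1, fun x s hs => LSeriesSummable_of_le_const_mul_rpow hs
    ⟨K * Real.exp (‖x‖ * K), fun n hn => (norm_hatExpCoeff_le hfa _ hn).trans ?_⟩⟩
  have hn' : (0 : ℝ) < n := by positivity
  have ht : ‖x + w * (Real.log n : ℂ)‖ ≤ ‖x‖ + ‖w‖ * Real.log n := by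
    refine (norm_add_le _ _).trans_eq ?_
    rw [norm_mul, Complex.norm_real, Real.norm_of_nonneg (Real.log_natCast_nonneg n)]
  calc K * Real.exp (‖x + w * (Real.log n : ℂ)‖ * K) * (n : ℝ) ^ (a + 1)
      ≤ K * Real.exp ((‖x‖ + ‖w‖ * Real.log n) * K) * (n : ℝ) ^ (a + 1) := by gcongr
    _ = K * Real.exp (‖x‖ * K) * (n : ℝ) ^ (a + 1 + ‖w‖ * K + 1 - 1) := by
      rw [add_sub_cancel_right, Real.rpow_add hn' (a + 1), Real.rpow_def_of_pos hn' (‖w‖ * K),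
        add_mul, Real.exp_add,
        show ‖w‖ * Real.log n * K = Real.log n * (‖w‖ * K) by ring]
      ring

/-! ### The polynomial family -/

/-- The polynomials generated by the Dirichlet series with coefficients `c`. -/
noncomputable def expPoly (c : ArithmeticFunction ℂ) : ArithmeticFunction ℂ[X] where
  toFun n := ∑ k ∈ range n, C ((c ^ k) n / (k.factorial : ℂ)) * X ^ k
  map_zero' := by simp

theorem expPoly_apply (c : ArithmeticFunction ℂ) (n : ℕ) :
    expPoly c n = ∑ k ∈ range n, C ((c ^ k) n / (k.factorial : ℂ)) * X ^ k := rfl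

theorem eval_expPoly (c : ArithmeticFunction ℂ) (n : ℕ) (x : ℂ) :
    (expPoly c n).eval x = expCoeff c x n := by
  rw [expPoly_apply, expCoeff_apply, eval_finsetSum]
  refine sum_congr rfl fun k _ => ?_
  simp only [eval_mul, eval_C, eval_pow, eval_X]
  ring

theorem expPoly_eq_X_mul {c : ArithmeticFunction ℂ} (hc : c 1 = 0) {n : ℕ} (hn : 2 ≤ n) :
    expPoly c n =
      X * ∑ k ∈ range n, C ((c ^ (k + 1)) n / ((k + 1).factorial : ℂ)) * X ^ k := by
  refine Polynomial.funext fun x => ?_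
  rw [eval_expPoly, ← mul_hatExpCoeff hc x hn, eval_mul, eval_X, hatExpCoeff_apply,
    eval_finsetSum]
  congr 1
  refine sum_congr rfl fun k _ => ?_
  simp only [eval_mul, eval_C, eval_pow, eval_X]
  ring

theorem divX_X_mul (p : ℂ[X]) : (X * p).divX = p := by
  ext n
  rw [coeff_divX, coeff_X_mul]

theorem hatCoeff_expPoly {c : ArithmeticFunction ℂ} (hc : c 1 = 0) (w x : ℂ) (n : ℕ) :
    hatCoeff (expPoly c) w x n = hatExpCoeff c (x + w * (Real.log n : ℂ)) n := by
  rw [hatCoeff]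
  split_ifs with hn
  · rw [hat, expPoly_eq_X_mul hc hn, divX_X_mul, hatExpCoeff_apply, eval_finsetSum]
    refine sum_congr rfl fun k _ => ?_
    simp only [eval_mul, eval_C, eval_pow, eval_X]
    ring
  · obtain rfl | rfl : n = 0 ∨ n = 1 := by omega
    · simp
    · rw [hatExpCoeff_apply_one hc]

theorem generates_expPoly {f : ArithmeticFunction ℂ} (hf : MemD₀ f) :
    Generates f (expPoly f) := by
  obtain ⟨hf₁, θ, hθ⟩ := hf
  refine fun x => ⟨θ, fun s hs => ⟨hθ s hs, ?_⟩⟩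
  simp only [eval_expPoly]
  exact LSeriesHasSum_expCoeff hf₁ (hθ s hs) x

theorem Generates.eq_expPoly {f : ArithmeticFunction ℂ} (hf : f 1 = 0)
    {α : ArithmeticFunction ℂ[X]} (hα : Generates f α) : α = expPoly f := by
  ext1 n
  refine Polynomial.funext fun x => ?_
  obtain ⟨θ, hθ⟩ := hα x
  let a : ArithmeticFunction ℂ := ⟨fun n => (α n).eval x, by simp⟩
  have h : a = expCoeff f x := eq_of_LSeries_eq (fun s hs => (hθ s hs).2)
    fun s hs => LSeriesHasSum_expCoeff hf (hθ s hs).1 x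
  rw [eval_expPoly, ← h]
  rfl

/-! ### Solutions of the functional equation and the final assembly -/

theorem Solves.shiftComp_eq {f g : ArithmeticFunction ℂ} {w : ℂ} (hf : MemD₀ f) (hg : MemD₀ g)
    (h : Solves f w g) : shiftComp w g f = g := by
  obtain ⟨-, a, ha⟩ := hf
  obtain ⟨θ₁, h₁⟩ := exists_LSeriesHasSum_shiftComp (ha (a + 1 : ℝ) (by simp)) hg w
  obtain ⟨θ₂, h₂⟩ := h
  refine eq_of_LSeries_eq (θ := max θ₁ θ₂) (u := LSeries g) (fun s hs => ?_) fun s hs =>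
    (h₂ s (lt_of_le_of_lt (le_max_right _ _) hs)).1.LSeriesHasSum
  have h := (h₁ s (lt_of_le_of_lt (le_max_left _ _) hs)).2.2
  rwa [(h₂ s (lt_of_le_of_lt (le_max_right _ _) hs)).2.2] at h

theorem solves_of_shiftComp_eq {f g : ArithmeticFunction ℂ} {w : ℂ} (hf : MemD₀ f) (hg : MemD₀ g)
    (h : shiftComp w g f = g) : Solves f w g := by
  obtain ⟨-, a, ha⟩ := hf
  obtain ⟨θ, hθ⟩ := exists_LSeriesHasSum_shiftComp (ha (a + 1 : ℝ) (by simp)) hg w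
  rw [h] at hθ
  exact ⟨θ, fun s hs => ⟨(hθ s hs).1, (hθ s hs).2.1, (hθ s hs).2.2.LSeries_eq.symm⟩⟩

theorem Solves.apply_eq {f g : ArithmeticFunction ℂ} {w : ℂ} (hf : MemD₀ f) (hg : MemD₀ g)
    (h : Solves f w g) (n : ℕ) : g n = hatExpCoeff f (w * (Real.log n : ℂ)) n := by
  have hfg := h.shiftComp_eq hf hg
  rcases lt_or_ge n 2 with hn | hn
  · interval_cases n
    · simp
    · rw [hg.1, hatExpCoeff_apply_one hf.1]
  · have := (shiftComp_eq_and_expCoeff_eq hf hg (w := w) fun m _ _ => by rw [hfg]).2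
    rw [← shiftComp_apply_eq hf.1 hn fun j hj _ => this j hj, hfg]

theorem exists_solves {f : ArithmeticFunction ℂ} (hf : MemD₀ f) (w : ℂ) :
    ∃ g : ArithmeticFunction ℂ, MemD₀ g ∧ Solves f w g := by
  obtain ⟨g, hgn⟩ : ∃ g : ArithmeticFunction ℂ,
      ∀ n : ℕ, g n = hatExpCoeff f (w * (Real.log n : ℂ)) n :=
    ⟨⟨fun n => hatExpCoeff f (w * (Real.log n : ℂ)) n, by simp⟩, fun _ => rfl⟩
  have hg : MemD₀ g := by
    obtain ⟨θ, hθ⟩ := exists_LSeriesSummable_hatExpCoeff hf w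
    refine ⟨by rw [hgn, hatExpCoeff_apply_one hf.1], θ, fun s hs => ?_⟩
    rw [funext hgn]
    simpa only [zero_add] using hθ 0 s hs
  exact ⟨g, hg, solves_of_shiftComp_eq hf hg
    (shiftComp_eq_and_expCoeff_eq hf hg fun m _ h => h.trans (hgn m).symm).1⟩

theorem Solves.exp_LSeries_eq {f g : ArithmeticFunction ℂ} {w : ℂ} (hf : MemD₀ f) (hg : MemD₀ g)
    (h : Solves f w g) {x s : ℂ} (hgs : LSeriesSummable g s)
    (hs : LSeriesSummable (fun n => hatExpCoeff f (x + w * (Real.log n : ℂ)) n) s) :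
    Complex.exp (x * LSeries g s) =
      1 + x * LSeries (fun n => hatExpCoeff f (x + w * (Real.log n : ℂ)) n) s := by
  have hfg := h.shiftComp_eq hf hg
  have hE := (shiftComp_eq_and_expCoeff_eq hf hg (w := w) fun m _ _ => by rw [hfg]).2
  have h₁ := LSeriesHasSum_expCoeff hg.1 hgs x
  have h₂ := (LSeriesHasSum_one s).add (hs.LSeriesHasSum.smul x)
  refine h₁.unique ((LSeriesHasSum_congr s _ fun {n} hn => ?_).mp h₂)
  simp only [Pi.add_apply, Pi.smul_apply, smul_eq_mul]
  rcases eq_or_ne n 1 with rfl | hn1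
  · rw [expCoeff_apply_one, hatExpCoeff_apply_one hf.1]
    simp
  · rw [hE n (by omega), ArithmeticFunction.one_apply_ne hn1, zero_add]

end DirichletLagrange

theorem mainTheorem1 (f : ArithmeticFunction ℂ) (hf : DirichletLagrange.MemD₀ f) (w : ℂ) :
    -- the functional equation has a unique solution in `𝒟₀`
    (∃! g : ArithmeticFunction ℂ, DirichletLagrange.MemD₀ g ∧ DirichletLagrange.Solves f w g) ∧
    -- there is a unique family of polynomials generated by `f`
    (∃! α : ArithmeticFunction (Polynomial ℂ), DirichletLagrange.Generates f α) ∧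
    ∀ α : ArithmeticFunction (Polynomial ℂ), DirichletLagrange.Generates f α →
      -- it is a family of Dirichlet convolution polynomials, and `αₙ(x) / x` is a polynomial
      DirichletLagrange.IsDirichletConvolution α ∧
      (∀ n : ℕ, 2 ≤ n → Polynomial.X * DirichletLagrange.hat (α n) = α n) ∧
      -- it gives the solution `g` and the exponentials `exp (x g(s))`
      ∀ g : ArithmeticFunction ℂ, DirichletLagrange.MemD₀ g → DirichletLagrange.Solves f w g →
        (∀ n : ℕ, g n = DirichletLagrange.hatCoeff α w 0 n) ∧
        ∃ θ : ℝ, ∀ s : ℂ, θ < s.re →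
          LSeriesHasSum (DirichletLagrange.hatCoeff α w 0) s (LSeries g s) ∧
          ∀ x : ℂ, LSeriesSummable (DirichletLagrange.hatCoeff α w x) s ∧
            Complex.exp (x * LSeries g s) =
              1 + x * LSeries (DirichletLagrange.hatCoeff α w x) s := by
  have hgen := DirichletLagrange.generates_expPoly hf
  obtain ⟨g, hg, hsol⟩ := DirichletLagrange.exists_solves hf w
  refine ⟨⟨g, ⟨hg, hsol⟩, fun g' ⟨hg', hsol'⟩ => ArithmeticFunction.ext fun n => ?_⟩,
    ⟨_, hgen, fun α hα => hα.eq_expPoly hf.1⟩, fun α hα => ?_⟩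
  · rw [hsol'.apply_eq hf hg', hsol.apply_eq hf hg]
  -- By uniqueness, only the explicit family remains to be treated.
  obtain rfl := hα.eq_expPoly hf.1
  refine ⟨fun n _ x y => ?_, fun n hn => ?_, fun g hg hsol => ?_⟩
  · simp only [DirichletLagrange.eval_expPoly]
    rw [DirichletLagrange.expCoeff_add hf, ArithmeticFunction.mul_apply,
      Nat.sum_divisorsAntidiagonal
        fun d e => DirichletLagrange.expCoeff f x d * DirichletLagrange.expCoeff f y e]
  · rw [DirichletLagrange.hat, DirichletLagrange.expPoly_eq_X_mul hf.1 hn, DirichletLagrange.divX_X_mul]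
  have hcoeff (x : ℂ) : DirichletLagrange.hatCoeff (DirichletLagrange.expPoly f) w x =
      fun n : ℕ => DirichletLagrange.hatExpCoeff f (x + w * (Real.log n : ℂ)) n :=
    funext (DirichletLagrange.hatCoeff_expPoly hf.1 w x)
  have hgcoeff (n : ℕ) : g n =
      DirichletLagrange.hatCoeff (DirichletLagrange.expPoly f) w 0 n := by
    simp only [hcoeff, zero_add, hsol.apply_eq hf hg n]
  refine ⟨hgcoeff, ?_⟩
  obtain ⟨θ₁, h₁⟩ := hg.2
  obtain ⟨θ₂, h₂⟩ := DirichletLagrange.exists_LSeriesSummable_hatExpCoeff hf w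
  refine ⟨max θ₁ θ₂, fun s hs => ?_⟩
  have hgs := h₁ s (lt_of_le_of_lt (le_max_left _ _) hs)
  refine ⟨?_, fun x => ?_⟩
  · rw [← funext hgcoeff]
    exact hgs.LSeriesHasSum
  · have hx := h₂ x s (lt_of_le_of_lt (le_max_right _ _) hs)
    rw [hcoeff]
    exact ⟨hx, hsol.exp_LSeries_eq hf hg hgs hx⟩
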